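/- Let $n\ge 1$, fix a logarithm base $b>1$, and let $x\in\mathbb{C}^n$ be a random vector whose distribution is absolutely continuous with respect to Lebesgue measure on $\mathbb{C}^n\cong\mathbb{R}^{2n}$. A random vector $c\in\mathbb{C}^n$ is called circular if $c$ and $e^{2\pi i\theta}c$ have the same distribution for every $\theta\in[0,1)$; let $\mathcal{C}_n$ be the set of circular random vectors in $\mathbb{C}^n$ with absolutely continuous distribution. The circular analog of $x$ is $x_{(a)}=e^{2\pi i\psi}x$, where $\psi$ is uniformly distributed on $[0,1)$ and independent of $x$. Write $D(x\|c)=\int f_x\log_b(f_x/f_c)\in[0,\infty]$ for the Kullback--Leibler divergence, $f_x,f_c$ being the probability densities. Write $x_k=r_ke^{2\pi i\phi_k}$ with $r_k\ge 0$, $\phi_k\in[0,1)$ (and $\phi_k=0$ if $r_k=0$). The sheared-polar representation of $x$ is $x^{(s)}=(r_1,\dots,r_n,[\phi_1-\phi_n],\dots,[\phi_{n-1}-\phi_n],\phi_n)$, where $[\cdot]$ denotes reduction modulo $1$ to $[0,1)$. Let $f_{x^{(s)}}$ be its density, let $\tilde x^{(s)}$ consist of its first $2n-1$ coordinates, with density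 $f_{\tilde x^{(s)}}(\tilde\xi)=\int_0^1 f_{x^{(s)}}(\tilde\xi,\varphi)\,d\varphi$, let $\widetilde{\mathcal S}_x=\{f_{\tilde x^{(s)}}\ne 0\}$, let $\vartheta=\phi_n$ be the last coordinate, and let $f_{\vartheta|\tilde x^{(s)}}(\varphi|\tilde\xi)=f_{x^{(s)}}(\tilde\xi,\varphi)/f_{\tilde x^{(s)}}(\tilde\xi)$ for $\tilde\xi\in\widetilde{\mathcal S}_x$. Then $x_{(a)}\in\mathcal{C}_n$, and $$D(x\|x_{(a)})=\inf_{c\in\mathcal{C}_n}D(x\|c)=\int_{\widetilde{\mathcal S}_x} f_{\tilde x^{(s)}}(\tilde\xi)\left(\int_0^1 f_{\vartheta|\tilde x^{(s)}}(\varphi|\tilde\xi)\log_b f_{\vartheta|\tilde x^{(s)}}(\varphi|\tilde\xi)\,d\varphi\right)d\tilde\xi ,$$ as an equality in $[0,\infty]$ (with $0\log_b 0=0$). Moreover, let $y\in\mathcal{C}_n$. If $y$ has the same distribution as $x_{(a)}$, then $D(x\|y)=\inf_{c\in\mathcal{C}_n}D(x\|c)$. Conversely, if this infimum is finite and $D(x\|y)=\inf_{c\in\mathcal{C}_n}D(x\|c)$,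 then $y$ has the same distribution as $x_{(a)}$. -/

import Mathlib

open MeasureTheory ProbabilityTheory Set
open scoped ENNReal

noncomputable section

namespace CircularAnalog

/-- The point `exp(2πiθ) z` of `ℂⁿ`. -/
def rotate {n : ℕ} (θ : ℝ) (z : Fin n → ℂ) : Fin n → ℂ :=
  Complex.exp (2 * Real.pi * Complex.I * θ) • z

/-- A random vector `X` in `ℂⁿ` is circular if it has the same distribution as
`exp(2πiθ) X` for every `θ ∈ [0,1)`. -/
def IsCircular {n : ℕ} {Ω : Type*} [MeasurableSpace Ω] (X : Ω → Fin n → ℂ)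
    (P : Measure Ω) : Prop :=
  ∀ θ ∈ Ico (0 : ℝ) 1, IdentDistrib X (fun ω => rotate θ (X ω)) P P

/-- The distributions of the circular random vectors in `ℂⁿ` whose distribution is absolutely
continuous with respect to Lebesgue measure. A distribution `μ` is the one of the random vector
`id` on the probability space `(ℂⁿ, μ)`, so this ranges over all such random vectors. -/
def circularLaws (n : ℕ) : Set (Measure (Fin n → ℂ)) :=
  {μ | IsProbabilityMeasure μ ∧ μ ≪ volume ∧ IsCircular id μ}

/-- The random vector `exp(2πiψ) X`. It is the circular analog of `X` when `ψ` is uniformly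
distributed on `[0,1)` and independent of `X`. -/
def analog {n : ℕ} {Ω : Type*} (ψ : Ω → ℝ) (X : Ω → Fin n → ℂ) : Ω → Fin n → ℂ :=
  fun ω => rotate (ψ ω) (X ω)

/-- Kullback-Leibler divergence of two probability distributions, logarithms taken to the
base `b > 1`. -/
def klDivBase {α : Type*} [MeasurableSpace α] (b : ℝ) (μ ν : Measure α) : ℝ≥0∞ :=
  InformationTheory.klDiv μ ν / ENNReal.ofReal (Real.log b)

/-- The angle of `z` as a number in `[0,1)`, in units of full turns; it is `0` for `z = 0`. -/
def angle (z : ℂ) : ℝ := Int.fract (Complex.arg z / (2 * Real.pi))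

/-- The sheared-polar representation `(r₁, …, rₙ₊₁, [φ₁ - φₙ₊₁], …, [φₙ - φₙ₊₁], φₙ₊₁)` of a
vector in `ℂⁿ⁺¹`, where `[·]` is reduction modulo `1` to `[0,1)`. -/
def shearedPolar {n : ℕ} (z : Fin (n + 1) → ℂ) :
    ((Fin (n + 1) → ℝ) × (Fin n → ℝ)) × ℝ :=
  ((fun i => ‖z i‖, fun i => Int.fract (angle (z i.castSucc) - angle (z (Fin.last n)))),
    angle (z (Fin.last n)))

variable {n : ℕ} {Ω : Type*} [MeasurableSpace Ω]

/-- Probability density of the sheared-polar representation of `X`. -/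
def shearedPdf (X : Ω → Fin (n + 1) → ℂ) (P : Measure Ω) :
    ((Fin (n + 1) → ℝ) × (Fin n → ℝ)) × ℝ → ℝ≥0∞ :=
  pdf (fun ω => shearedPolar (X ω)) P volume

/-- Probability density of the sheared-polar representation of `X` without its last angle. -/
def reducedPdf (X : Ω → Fin (n + 1) → ℂ) (P : Measure Ω)
    (ξ : (Fin (n + 1) → ℝ) × (Fin n → ℝ)) : ℝ≥0∞ :=
  ∫⁻ φ in Ico (0 : ℝ) 1, shearedPdf X P (ξ, φ)

/-- The set where the density of the reduced vector does not vanish. -/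
def reducedSupport (X : Ω → Fin (n + 1) → ℂ) (P : Measure Ω) :
    Set ((Fin (n + 1) → ℝ) × (Fin n → ℝ)) :=
  {ξ | reducedPdf X P ξ ≠ 0}

/-- Conditional density of the last angle given the other sheared-polar coordinates (for `ξ` in
the support). -/
def condPdf (X : Ω → Fin (n + 1) → ℂ) (P : Measure Ω)
    (ξ : (Fin (n + 1) → ℝ) × (Fin n → ℝ)) (φ : ℝ) : ℝ≥0∞ :=
  shearedPdf X P (ξ, φ) / reducedPdf X P ξ

/-- The Lebesgue integral of an extended-real-valued function, as the integral of its positive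
part minus the integral of its negative part (meaningful if one of them is finite). -/
def extIntegral {α : Type*} [MeasurableSpace α] (μ : Measure α) (g : α → EReal) : EReal :=
  ((∫⁻ x, (g x).toENNReal ∂μ : ℝ≥0∞) : EReal) - ((∫⁻ x, (-g x).toENNReal ∂μ : ℝ≥0∞) : EReal)

/-- With `f` the density of the reduced vector, `S` its support and `c(φ|ξ)` the conditional
density of the last angle, this is `∫_S f(ξ) (∫₀¹ c(φ|ξ) log_b c(φ|ξ) dφ) dξ`. -/
def condAngleIntegral (b : ℝ) (X : Ω → Fin (n + 1) → ℂ) (P : Measure Ω) : EReal :=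
  extIntegral (volume.restrict (reducedSupport X P)) fun ξ =>
    (reducedPdf X P ξ : EReal) *
      extIntegral (volume.restrict (Ico (0 : ℝ) 1)) fun φ =>
        (((condPdf X P ξ φ).toReal * Real.logb b (condPdf X P ξ φ).toReal : ℝ) : EReal)

end CircularAnalog

end

/-! ### Rotations in sheared-polar coordinates -/

namespace CircularAnalog

/-! Off the null set where some coordinate vanishes, rotating by `θ` only shifts the last
sheared-polar angle by `θ` modulo 1. A law on `α × ℝ` invariant under these shifts is its first
marginal times the uniform law (`eq_fst_prod_unifTurn_of_invariant`). So every circular law `c`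
becomes such a product, and the circular analog of `μ` becomes the product built on the marginal of
`μ` itself.

The chain rule for the divergence from a product (`klDiv_prod_eq_add`) then gives the Pythagorean
identity `klDiv_of_mem_circularLaws`: D(μ‖c) is the divergence of the reduced marginals plus
D(μ‖μ_(a)). The second term does not involve `c`, and the first is zero exactly when the marginals
agree. This yields the infimum, and uniqueness of the minimizer once the common term is finite and
can be cancelled.

Written with densities, the second term is the conditional entropy integral
(`condAngleIntegral_eq`). No Jacobian is computed: divergence is unchanged by any measurable map
with a measurable left inverse, and only the existence of the sheared-polar density is needed. -/

lemma exp_turn_add_int (t : ℝ) (k : ℤ) :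
    Complex.exp (2 * Real.pi * Complex.I * ((t + k : ℝ) : ℂ)) =
      Complex.exp (2 * Real.pi * Complex.I * (t : ℂ)) := by
  rw [Complex.exp_eq_exp_iff_exists_int]
  exact ⟨k, by push_cast; ring⟩

lemma exp_turn_fract (t : ℝ) :
    Complex.exp (2 * Real.pi * Complex.I * ((Int.fract t : ℝ) : ℂ)) =
      Complex.exp (2 * Real.pi * Complex.I * (t : ℂ)) := by
  conv_rhs => rw [← Int.fract_add_floor t]
  rw [exp_turn_add_int]

lemma norm_exp_turn (t : ℝ) : ‖Complex.exp (2 * Real.pi * Complex.I * (t : ℂ))‖ = 1 := by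
  have : (2 * Real.pi * Complex.I * (t : ℂ)) = ((2 * Real.pi * t : ℝ) : ℂ) * Complex.I := by
    push_cast; ring
  rw [this, Complex.norm_exp_ofReal_mul_I]

lemma norm_mul_exp_turn_angle (z : ℂ) :
    (‖z‖ : ℂ) * Complex.exp (2 * Real.pi * Complex.I * (angle z : ℂ)) = z := by
  rw [angle, exp_turn_fract]
  conv_rhs => rw [← Complex.norm_mul_exp_arg_mul_I z]
  congr 2
  have : (Real.pi : ℂ) ≠ 0 := by exact_mod_cast Real.pi_ne_zero
  push_cast
  field_simp

lemma angle_exp_turn_mul (θ : ℝ) {z : ℂ} (hz : z ≠ 0) :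
    angle (Complex.exp (2 * Real.pi * Complex.I * (θ : ℂ)) * z) = Int.fract (angle z + θ) := by
  have h1 : ((Complex.arg (Complex.exp (2 * Real.pi * Complex.I * (θ : ℂ)) * z) : ℝ) :
      Real.Angle) = ((2 * Real.pi * θ + Complex.arg z : ℝ) : Real.Angle) := by
    rw [Complex.arg_mul_coe_angle (Complex.exp_ne_zero _) hz, Real.Angle.coe_add]
    congr 1
    have : (2 * Real.pi * Complex.I * (θ : ℂ)) = ((2 * Real.pi * θ : ℝ) : ℂ) * Complex.I := by
      push_cast; ring
    rw [this, Complex.arg_exp_mul_I, Real.Angle.coe_toIocMod]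
  obtain ⟨k, hk⟩ := Real.Angle.angle_eq_iff_two_pi_dvd_sub.1 h1
  have h2 : Int.fract (angle z + θ) = Int.fract (Complex.arg z / (2 * Real.pi) + θ) := by
    rw [Int.fract_eq_fract]
    refine ⟨-⌊Complex.arg z / (2 * Real.pi)⌋, ?_⟩
    rw [angle, Int.fract]; push_cast; ring
  rw [h2, angle, Int.fract_eq_fract]
  refine ⟨k, ?_⟩
  have hpi := Real.pi_ne_zero
  rw [sub_eq_iff_eq_add] at hk
  rw [hk]
  field_simp
  ring

lemma angle_mem_Ico (z : ℂ) : angle z ∈ Ico (0 : ℝ) 1 :=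
  ⟨Int.fract_nonneg _, Int.fract_lt_one _⟩

@[fun_prop]
lemma measurable_angle : Measurable angle :=
  (Complex.measurable_arg.div_const _).fract

/-- The inverse of the sheared-polar representation. -/
noncomputable def shearedPolarInv {n : ℕ} (p : ((Fin (n + 1) → ℝ) × (Fin n → ℝ)) × ℝ) : Fin (n + 1) → ℂ :=
  fun i => (p.1.1 i : ℂ) * Complex.exp (2 * Real.pi * Complex.I *
    ((Fin.lastCases (motive := fun _ => ℝ) 0 p.1.2 i + p.2 : ℝ) : ℂ))

variable {n : ℕ}

lemma shearedPolarInv_shearedPolar (z : Fin (n + 1) → ℂ) :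
    shearedPolarInv (shearedPolar z) = z := by
  ext i
  refine Fin.lastCases ?_ (fun j => ?_) i
  · simp only [shearedPolarInv, shearedPolar, Fin.lastCases_last, zero_add]
    exact norm_mul_exp_turn_angle _
  · simp only [shearedPolarInv, shearedPolar, Fin.lastCases_castSucc]
    conv_rhs => rw [← norm_mul_exp_turn_angle (z j.castSucc)]
    congr 1
    rw [← exp_turn_add_int _ ⌊angle (z j.castSucc) - angle (z (Fin.last n))⌋, Int.fract]
    congr 3
    ring

lemma differentiable_shearedPolarInv : Differentiable ℝ (shearedPolarInv (n := n)) := by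
  rw [differentiable_pi]
  intro i
  have h2 : Differentiable ℝ fun p : ((Fin (n + 1) → ℝ) × (Fin n → ℝ)) × ℝ =>
      (Fin.lastCases (motive := fun _ => ℝ) 0 p.1.2 i + p.2 : ℝ) := by
    refine Fin.lastCases ?_ (fun j => ?_) i
    · simp only [Fin.lastCases_last]; fun_prop
    · simp only [Fin.lastCases_castSucc]; fun_prop
  have h3 := Complex.ofRealCLM.differentiable.comp h2
  have h1 : Differentiable ℝ fun p : ((Fin (n + 1) → ℝ) × (Fin n → ℝ)) × ℝ => p.1.1 i := by
    fun_prop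
  exact (Complex.ofRealCLM.differentiable.comp h1).mul
    ((h3.const_mul (2 * Real.pi * Complex.I : ℂ)).cexp)

lemma measurable_shearedPolarInv : Measurable (shearedPolarInv (n := n)) :=
  differentiable_shearedPolarInv.continuous.measurable

lemma measurable_shearedPolar : Measurable (shearedPolar (n := n)) := by
  unfold shearedPolar
  refine Measurable.prodMk (Measurable.prodMk ?_ ?_) ?_
  · exact measurable_pi_lambda _ fun i => by fun_prop
  · exact measurable_pi_lambda _ fun i => Measurable.fract (by fun_prop)
  · fun_prop

/-- Nonvanishing matters: the angle of `0` is set to `0`, so rotation does not shift it. -/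
lemma shearedPolar_rotate (θ : ℝ) {z : Fin (n + 1) → ℂ} (hz : ∀ i, z i ≠ 0) :
    shearedPolar (rotate θ z) =
      ((shearedPolar z).1, Int.fract ((shearedPolar z).2 + θ)) := by
  simp only [shearedPolar, rotate, Pi.smul_apply, smul_eq_mul, angle_exp_turn_mul θ (hz _),
    norm_mul, norm_exp_turn, one_mul]
  congr 2
  ext i
  rw [Int.fract_eq_fract]
  refine ⟨-⌊angle (z i.castSucc) + θ⌋ + ⌊angle (z (Fin.last n)) + θ⌋, ?_⟩
  rw [Int.fract, Int.fract]; push_cast; ring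

lemma measurable_rotate_uncurry :
    Measurable fun p : ℝ × (Fin n → ℂ) => rotate p.1 p.2 := by
  unfold rotate
  fun_prop

lemma measurable_rotate (θ : ℝ) : Measurable (rotate (n := n) θ) := by
  unfold rotate
  fun_prop

lemma rotate_add (θ η : ℝ) (z : Fin n → ℂ) : rotate (θ + η) z = rotate θ (rotate η z) := by
  simp only [rotate, smul_smul, ← Complex.exp_add]
  congr 2
  push_cast; ring

lemma rotate_fract (θ : ℝ) (z : Fin n → ℂ) : rotate (Int.fract θ) z = rotate θ z := by
  simp only [rotate, exp_turn_fract]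

lemma measurePreserving_rotate (θ : ℝ) :
    MeasurePreserving (rotate (n := n) θ) volume volume := by
  have hc : MeasurePreserving
      (fun z : ℂ => Complex.exp (2 * Real.pi * Complex.I * (θ : ℂ)) * z) volume volume := by
    let u : Circle := ⟨Complex.exp (2 * Real.pi * Complex.I * (θ : ℂ)), 
      mem_sphere_zero_iff_norm.2 (norm_exp_turn θ)⟩
    exact (rotation u).measurePreserving
  exact volume_preserving_pi (fun _ : Fin n => hc)

/-- The preimage of a null set `A` lies in the image of `A` under the differentiable inverse, and
differentiable maps between spaces of equal dimension preserve null sets. -/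
lemma absolutelyContinuous_map_shearedPolar {μ : Measure (Fin (n + 1) → ℂ)} (hμ : μ ≪ volume) :
    μ.map shearedPolar ≪ volume := by
  -- Both spaces have real dimension `2(n + 1)`; `L` turns the inverse into a self-map of `ℂⁿ⁺¹`, as
  -- the null-image theorem requires.
  let L : (((Fin (n + 1) → ℝ) × (Fin n → ℝ)) × ℝ) ≃L[ℝ] (Fin (n + 1) → ℂ) :=
    ContinuousLinearEquiv.ofFinrankEq (by
      simp [Module.finrank_pi_fintype, Complex.finrank_real_complex]; ring)
  refine Measure.AbsolutelyContinuous.mk fun A hA hA0 => ?_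
  rw [Measure.map_apply measurable_shearedPolar hA]
  apply hμ
  have h1 : volume (L.symm ⁻¹' A) = 0 := by
    have hsf : SigmaFinite ((volume : Measure (Fin (n + 1) → ℂ)).map L.symm) :=
      L.symm.toHomeomorph.toMeasurableEquiv.sigmaFinite_map
    have hhaar : ((volume : Measure (Fin (n + 1) → ℂ)).map L.symm).IsAddHaarMeasure :=
      L.symm.isAddHaarMeasure_map _
    have hprod : (volume : Measure ((Fin (n + 1) → ℝ) × (Fin n → ℝ))).IsAddHaarMeasure := by
      exact Measure.prod.instIsAddHaarMeasure _ _
    have hprod' : (volume : Measure (((Fin (n + 1) → ℝ) × (Fin n → ℝ)) × ℝ)).IsAddHaarMeasure := by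
      rw [Measure.volume_eq_prod]; infer_instance
    have hac : (volume : Measure (Fin (n + 1) → ℂ)).map L.symm ≪ volume :=
      Measure.absolutelyContinuous_isAddHaarMeasure _ _
    rw [← Measure.map_apply L.symm.continuous.measurable hA]
    exact hac hA0
  have h2 : volume ((shearedPolarInv ∘ L.symm) '' (L.symm ⁻¹' A)) = 0 :=
    addHaar_image_eq_zero_of_differentiableOn_of_addHaar_eq_zero volume
      (differentiable_shearedPolarInv.comp L.symm.differentiable).differentiableOn h1
  refine measure_mono_null (fun z hz => ?_) h2
  refine ⟨L (shearedPolar z), by simpa using hz, ?_⟩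
  simp [shearedPolarInv_shearedPolar]

end CircularAnalog

/-! ### Shift invariance and uniform last angle -/

namespace CircularAnalog

/-- The uniform distribution on `[0,1)`. -/
noncomputable abbrev unifTurn : Measure ℝ := volume.restrict (Ico (0 : ℝ) 1)

instance : IsProbabilityMeasure unifTurn := ⟨by simp [unifTurn]⟩

/-- The set `Int.fract ⁻¹' B` is 1-periodic, so it has the same measure in every interval of length
1, each being a fundamental domain for the integers. -/
lemma unifTurn_preimage_fract_add (φ : ℝ) {B : Set ℝ} (hB : MeasurableSet B) :
    unifTurn ((fun θ => Int.fract (φ + θ)) ⁻¹' B) = unifTurn B := by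
  let A : Set ℝ := Int.fract ⁻¹' B
  have hA : MeasurableSet A := measurable_fract hB
  have hinv : ∀ g : (AddSubgroup.zmultiples (1 : ℝ)), (g +ᵥ ·) ⁻¹' A = A := by
    rintro ⟨_, k, rfl⟩
    ext x
    simp [A, AddSubgroup.vadd_def]
  have h1 : volume (A ∩ Ioc φ (φ + 1)) = volume (A ∩ Ioc 0 (0 + 1)) :=
    (isAddFundamentalDomain_Ioc one_pos φ volume).measure_set_eq
      (isAddFundamentalDomain_Ioc one_pos 0 volume) hA hinv
  have hU : unifTurn = volume.restrict (Ioc (0 : ℝ) 1) := restrict_Ico_eq_restrict_Ioc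
  have h2 : unifTurn B = unifTurn A := by
    rw [Measure.restrict_apply hB, Measure.restrict_apply hA]
    congr 1
    ext x
    simp only [mem_inter_iff, A, mem_preimage, and_congr_left_iff]
    intro hx
    rw [Int.fract_eq_self.2 hx]
  have hmeas : Measurable fun θ : ℝ => Int.fract (φ + θ) := (by fun_prop : Measurable _).fract
  rw [h2, hU, Measure.restrict_apply hA, Measure.restrict_apply (hmeas hB)]
  rw [zero_add] at h1
  rw [← h1, ← measure_preimage_add volume φ (A ∩ Ioc φ (φ + 1))]
  congr 1
  ext x
  simp [A]

variable {α : Type*} [MeasurableSpace α]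

lemma measurable_fract_shift :
    Measurable fun q : ℝ × (α × ℝ) => (q.2.1, Int.fract (q.2.2 + q.1)) :=
  Measurable.prodMk (by fun_prop) (by fun_prop : Measurable _).fract

lemma measurable_fract_shift_const (θ : ℝ) :
    Measurable fun p : α × ℝ => (p.1, Int.fract (p.2 + θ)) :=
  measurable_fract_shift.comp measurable_prodMk_left

/-- For each fixed point `p`, a uniform shift makes the angle uniform whatever `p.2` was, hence
independent of `p.1`. -/
lemma map_fract_shift_prod (m : Measure (α × ℝ)) [IsFiniteMeasure m] :
    (unifTurn.prod m).map (fun q => (q.2.1, Int.fract (q.2.2 + q.1))) = m.fst.prod unifTurn := by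
  symm
  refine Measure.prod_eq fun A B hA hB => ?_
  rw [Measure.map_apply measurable_fract_shift (hA.prod hB),
    Measure.prod_apply_symm (measurable_fract_shift (hA.prod hB)), Measure.fst_apply hA]
  have : ∀ p : α × ℝ, unifTurn ((fun θ => (θ, p)) ⁻¹' ((fun q : ℝ × (α × ℝ) =>
      (q.2.1, Int.fract (q.2.2 + q.1))) ⁻¹' (A ×ˢ B))) =
      (Prod.fst ⁻¹' A).indicator (fun _ => unifTurn B) p := by
    intro p
    by_cases hp : p.1 ∈ A
    · rw [indicator_of_mem (by exact hp), ← unifTurn_preimage_fract_add p.2 hB]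
      congr 1
      ext θ
      simp [hp]
    · rw [indicator_of_notMem (by exact hp)]
      convert measure_empty (μ := unifTurn)
      ext θ
      simp [hp]
  simp_rw [this]
  rw [lintegral_indicator (measurable_fst hA), setLIntegral_const, mul_comm]

/-- Averaging over the shifts leaves an invariant `m` unchanged, yet by `map_fract_shift_prod` it
produces the product. -/
lemma eq_fst_prod_unifTurn_of_invariant (m : Measure (α × ℝ)) [IsFiniteMeasure m]
    (h : ∀ θ ∈ Ico (0 : ℝ) 1, m.map (fun p => (p.1, Int.fract (p.2 + θ))) = m) :
    m = m.fst.prod unifTurn := by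
  rw [← map_fract_shift_prod]
  ext s hs
  rw [Measure.map_apply measurable_fract_shift hs, Measure.prod_apply (measurable_fract_shift hs)]
  have : ∀ᵐ θ ∂unifTurn, m (Prod.mk θ ⁻¹' ((fun q : ℝ × (α × ℝ) =>
      (q.2.1, Int.fract (q.2.2 + q.1))) ⁻¹' s)) = m s := by
    filter_upwards [ae_restrict_mem measurableSet_Ico] with θ hθ
    conv_rhs =>
      rw [← h θ hθ, Measure.map_apply (measurable_fract_shift_const θ) hs]
    rfl
  rw [lintegral_congr_ae this]
  simp

variable {n : ℕ}

lemma ae_forall_ne_zero {μ : Measure (Fin n → ℂ)} (hμ : μ ≪ volume) :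
    ∀ᵐ z ∂μ, ∀ i, z i ≠ 0 := by
  refine hμ.ae_le (ae_all_iff.2 fun i => ?_)
  exact (Measure.quasiMeasurePreserving_eval (fun _ : Fin n => (volume : Measure ℂ)) i).ae
    (Measure.ae_ne volume 0)

lemma isCircular_id_iff {μ : Measure (Fin n → ℂ)} :
    IsCircular id μ ↔ ∀ θ ∈ Ico (0 : ℝ) 1, μ.map (rotate θ) = μ := by
  refine forall₂_congr fun θ _ => ⟨fun h => ?_, fun h => ?_⟩
  · simpa using h.map_eq.symm
  · exact ⟨aemeasurable_id, (measurable_rotate θ).aemeasurable, by simpa using h.symm⟩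

/-- The law of `exp(2πiθ) x` where `x` has law `μ` and `θ` is independent and uniform. -/
noncomputable def circularize (μ : Measure (Fin n → ℂ)) : Measure (Fin n → ℂ) :=
  (unifTurn.prod μ).map fun p => rotate p.1 p.2

lemma circularize_mem_circularLaws (μ : Measure (Fin n → ℂ)) [IsProbabilityMeasure μ]
    (hμ : μ ≪ volume) : circularize μ ∈ circularLaws n := by
  refine ⟨Measure.isProbabilityMeasure_map measurable_rotate_uncurry.aemeasurable, ?_, ?_⟩
  · refine Measure.AbsolutelyContinuous.mk fun A hA hA0 => ?_
    rw [circularize, Measure.map_apply measurable_rotate_uncurry hA,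
      Measure.prod_apply (measurable_rotate_uncurry hA)]
    have : ∀ θ : ℝ, μ (Prod.mk θ ⁻¹' ((fun p : ℝ × (Fin n → ℂ) => rotate p.1 p.2) ⁻¹' A)) = 0 :=
      fun θ => hμ (((measurePreserving_rotate θ).measure_preimage hA.nullMeasurableSet).trans hA0)
    simp [this]
  · rw [isCircular_id_iff]
    intro θ _
    have hf : Measurable fun η : ℝ => Int.fract (θ + η) := (by fun_prop : Measurable _).fract
    have hU : unifTurn.map (fun η => Int.fract (θ + η)) = unifTurn := by
      ext B hB
      rw [Measure.map_apply hf hB, unifTurn_preimage_fract_add θ hB]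
    rw [circularize, Measure.map_map (measurable_rotate θ) measurable_rotate_uncurry]
    conv_rhs => rw [← hU, ← Measure.map_id (μ := μ), Measure.map_prod_map _ _ hf measurable_id,
      Measure.map_map measurable_rotate_uncurry (hf.prodMap measurable_id)]
    congr 1
    ext1 p
    simp [rotate_fract, rotate_add]

lemma map_shearedPolar_of_mem_circularLaws {c : Measure (Fin (n + 1) → ℂ)}
    (hc : c ∈ circularLaws (n + 1)) :
    c.map shearedPolar = (c.map shearedPolar).fst.prod unifTurn := by
  obtain ⟨_, hac, hcirc⟩ := hc
  rw [isCircular_id_iff] at hcirc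
  have := Measure.isProbabilityMeasure_map (μ := c) (measurable_shearedPolar (n := n)).aemeasurable
  refine eq_fst_prod_unifTurn_of_invariant _ fun θ hθ => ?_
  rw [Measure.map_map (measurable_fract_shift_const θ) measurable_shearedPolar]
  conv_rhs => rw [← hcirc θ hθ, Measure.map_map measurable_shearedPolar (measurable_rotate θ)]
  refine Measure.map_congr ?_
  filter_upwards [ae_forall_ne_zero hac] with z hz
  exact (shearedPolar_rotate θ hz).symm

lemma map_shearedPolar_circularize (μ : Measure (Fin (n + 1) → ℂ)) [IsProbabilityMeasure μ]
    (hμ : μ ≪ volume) :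
    (circularize μ).map shearedPolar = (μ.map shearedPolar).fst.prod unifTurn := by
  have := Measure.isProbabilityMeasure_map (μ := μ) (measurable_shearedPolar (n := n)).aemeasurable
  rw [circularize, Measure.map_map measurable_shearedPolar measurable_rotate_uncurry,
    ← map_fract_shift_prod]
  conv_rhs => rw [← Measure.map_id (μ := unifTurn),
    Measure.map_prod_map _ _ measurable_id measurable_shearedPolar,
    Measure.map_map measurable_fract_shift (measurable_id.prodMap measurable_shearedPolar)]
  refine Measure.map_congr ?_
  filter_upwards [Measure.quasiMeasurePreserving_snd.ae (ae_forall_ne_zero hμ)] with p hp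
  exact shearedPolar_rotate p.1 hp

lemma map_shearedPolar_injective {μ ν : Measure (Fin (n + 1) → ℂ)}
    (h : μ.map shearedPolar = ν.map shearedPolar) : μ = ν := by
  have h' := congrArg (Measure.map shearedPolarInv) h
  rw [Measure.map_map measurable_shearedPolarInv measurable_shearedPolar,
    Measure.map_map measurable_shearedPolarInv measurable_shearedPolar] at h'
  have hid : shearedPolarInv ∘ shearedPolar (n := n) = id :=
    funext shearedPolarInv_shearedPolar
  simpa [hid] using h'

end CircularAnalog

/-! ### Divergence: invariance and chain rule -/

namespace InformationTheory

/-- Data processing, applied once to `f` and once to `g`. -/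
lemma klDiv_map_eq_of_leftInverse {α β : Type*} [MeasurableSpace α] [MeasurableSpace β]
    (μ ν : Measure α) [IsFiniteMeasure μ] [IsFiniteMeasure ν] {f : α → β} {g : β → α}
    (hf : Measurable f) (hg : Measurable g) (hgf : Function.LeftInverse g f) :
    klDiv (μ.map f) (ν.map f) = klDiv μ ν := by
  refine le_antisymm (klDiv_map_le μ ν hf) ?_
  have h := klDiv_map_le (μ.map f) (ν.map f) hg
  simpa [Measure.map_map hg hf, hgf.comp_eq_id] using h

/-- Chain rule for the disintegration of `m`, with a product measure seen as a constant kernel. -/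
lemma klDiv_prod_eq_add {α β : Type*} [MeasurableSpace α] [MeasurableSpace β]
    [StandardBorelSpace β] [Nonempty β]
    (m : Measure (α × β)) [IsFiniteMeasure m] (ν : Measure α) [IsFiniteMeasure ν]
    (ρ : Measure β) [IsProbabilityMeasure ρ] :
    klDiv m (ν.prod ρ) = klDiv m.fst ν + klDiv m (m.fst.prod ρ) := by
  have h := klDiv_compProd_eq_add m.fst ν m.condKernel (Kernel.const α ρ)
  rwa [m.disintegrate m.condKernel, Measure.compProd_const, Measure.compProd_const] at h

end InformationTheory

/-! ### Minimization over circular laws -/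

namespace CircularAnalog

open InformationTheory

variable {n : ℕ}

lemma klDiv_circularize (μ : Measure (Fin (n + 1) → ℂ)) [IsProbabilityMeasure μ]
    (hμ : μ ≪ volume) :
    klDiv μ (circularize μ) =
      klDiv (μ.map shearedPolar) ((μ.map shearedPolar).fst.prod unifTurn) := by
  have := (circularize_mem_circularLaws μ hμ).1
  rw [← map_shearedPolar_circularize μ hμ, klDiv_map_eq_of_leftInverse _ _ measurable_shearedPolar
    measurable_shearedPolarInv shearedPolarInv_shearedPolar]

/-- Pythagorean identity: only the first summand depends on `c`. -/
lemma klDiv_of_mem_circularLaws (μ : Measure (Fin (n + 1) → ℂ)) [IsProbabilityMeasure μ]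
    (hμ : μ ≪ volume) {c : Measure (Fin (n + 1) → ℂ)} (hc : c ∈ circularLaws (n + 1)) :
    klDiv μ c = klDiv (μ.map shearedPolar).fst (c.map shearedPolar).fst +
      klDiv μ (circularize μ) := by
  have := hc.1
  have := Measure.isProbabilityMeasure_map (μ := c) (measurable_shearedPolar (n := n)).aemeasurable
  rw [klDiv_circularize μ hμ, ← klDiv_prod_eq_add, ← map_shearedPolar_of_mem_circularLaws hc,
    klDiv_map_eq_of_leftInverse _ _ measurable_shearedPolar
    measurable_shearedPolarInv shearedPolarInv_shearedPolar]

lemma klDivBase_circularize_le (b : ℝ) (μ : Measure (Fin (n + 1) → ℂ)) [IsProbabilityMeasure μ]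
    (hμ : μ ≪ volume) {c : Measure (Fin (n + 1) → ℂ)} (hc : c ∈ circularLaws (n + 1)) :
    klDivBase b μ (circularize μ) ≤ klDivBase b μ c := by
  refine ENNReal.div_le_div_right ?_ _
  rw [klDiv_of_mem_circularLaws μ hμ hc]
  exact le_add_self

lemma iInf_klDivBase_circularLaws (b : ℝ) (μ : Measure (Fin (n + 1) → ℂ))
    [IsProbabilityMeasure μ] (hμ : μ ≪ volume) :
    ⨅ c ∈ circularLaws (n + 1), klDivBase b μ c = klDivBase b μ (circularize μ) :=
  le_antisymm (iInf₂_le _ (circularize_mem_circularLaws μ hμ))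
    (le_iInf₂ fun _ hc => klDivBase_circularize_le b μ hμ hc)

lemma eq_circularize_of_klDivBase_eq {b : ℝ} (hb : 1 < b) (μ : Measure (Fin (n + 1) → ℂ))
    [IsProbabilityMeasure μ] (hμ : μ ≪ volume) {c : Measure (Fin (n + 1) → ℂ)}
    (hc : c ∈ circularLaws (n + 1)) (hfin : klDivBase b μ (circularize μ) ≠ ∞)
    (h : klDivBase b μ c = klDivBase b μ (circularize μ)) : c = circularize μ := by
  have hlog : ENNReal.ofReal (Real.log b) ≠ 0 := by
    simpa using Real.log_pos hb
  rw [klDivBase, klDivBase, ENNReal.div_eq_div_iff hlog ENNReal.ofReal_ne_top hlog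
    ENNReal.ofReal_ne_top, ENNReal.mul_right_inj hlog ENNReal.ofReal_ne_top,
    klDiv_of_mem_circularLaws μ hμ hc] at h
  have hfin' : klDiv μ (circularize μ) ≠ ∞ := by
    intro htop
    rw [klDivBase, htop, ENNReal.top_div_of_ne_top ENNReal.ofReal_ne_top] at hfin
    exact hfin rfl
  -- Finiteness allows cancelling the common term.
  have h0 : klDiv (μ.map shearedPolar).fst (c.map shearedPolar).fst = 0 := by
    refine (ENNReal.add_left_inj hfin').1 ?_
    rw [h, zero_add]
  have := hc.1
  rw [klDiv_eq_zero_iff] at h0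
  apply map_shearedPolar_injective
  rw [map_shearedPolar_of_mem_circularLaws hc, map_shearedPolar_circularize μ hμ, h0]

end CircularAnalog

/-! ### The conditional entropy formula -/

namespace CircularAnalog

open InformationTheory

variable {n : ℕ} {Ω : Type*} [MeasurableSpace Ω]

lemma map_analog {P : Measure Ω} [IsProbabilityMeasure P] {X : Ω → Fin n → ℂ}
    (hX : Measurable X) {ψ : Ω → ℝ} (hψ : Measurable ψ)
    (hψunif : pdf.IsUniform ψ (Ico (0 : ℝ) 1) P volume) (hindep : IndepFun ψ X P) :
    P.map (analog ψ X) = circularize (P.map X) := by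
  have hU : P.map ψ = unifTurn := by
    rw [hψunif, ProbabilityTheory.cond]
    simp
  rw [indepFun_iff_map_prod_eq_prod_map_map hψ.aemeasurable hX.aemeasurable, hU] at hindep
  rw [circularize, ← hindep, Measure.map_map measurable_rotate_uncurry (hψ.prodMk hX)]
  rfl

/-- The entropy integral of a probability density with respect to a probability measure. -/
lemma extIntegral_mul_logb {α : Type*} [MeasurableSpace α] (ρ : Measure α)
    [IsProbabilityMeasure ρ] {b : ℝ} (hb : 1 < b) {c : α → ℝ≥0∞} (hc : Measurable c)
    (hc1 : ∫⁻ x, c x ∂ρ = 1) :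
    extIntegral ρ (fun x => (((c x).toReal * Real.logb b (c x).toReal : ℝ) : EReal)) =
      (((∫⁻ x, ENNReal.ofReal (klFun (c x).toReal) ∂ρ) / ENNReal.ofReal (Real.log b) : ℝ≥0∞) :
        EReal) := by
  have hL := Real.log_pos hb
  have hL0 : ENNReal.ofReal (Real.log b) ≠ 0 := by simpa using hL
  set g : α → ℝ := fun x => (c x).toReal * Real.logb b (c x).toReal with hg
  have hgm : Measurable g := by
    have := hc.ennreal_toReal
    exact this.mul (this.log.div_const _)
  -- From `klFun u = u log u + 1 - u ≥ 0` and `u ≥ 0` one gets `-u log u ≤ 1`, so the negative part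
  -- is integrable.
  have hneg : ∫⁻ x, ENNReal.ofReal (-g x) ∂ρ ≠ ∞ := by
    refine ne_top_of_le_ne_top (b := ENNReal.ofReal (1 / Real.log b)) ENNReal.ofReal_ne_top ?_
    calc ∫⁻ x, ENNReal.ofReal (-g x) ∂ρ ≤ ∫⁻ _, ENNReal.ofReal (1 / Real.log b) ∂ρ := by
          refine lintegral_mono fun x => ENNReal.ofReal_le_ofReal ?_
          rw [le_div_iff₀ hL, hg]
          have h := klFun_nonneg (x := (c x).toReal) ENNReal.toReal_nonneg
          have h' : (0 : ℝ) ≤ (c x).toReal := ENNReal.toReal_nonneg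
          rw [klFun_apply] at h
          simp only [Real.logb]
          field_simp
          linarith
      _ = _ := by simp
  have hcfin : ∀ᵐ x ∂ρ, c x < ∞ := ae_lt_top hc (by simp [hc1])
  -- The formula for `klFun`, rearranged so that every term is nonnegative; it integrates without
  -- integrability assumptions, and then `∫ c = 1 = ∫ 1` cancels.
  have hpt : ∀ᵐ x ∂ρ, ENNReal.ofReal (klFun (c x).toReal) + c x +
      ENNReal.ofReal (Real.log b) * ENNReal.ofReal (-g x) =
      ENNReal.ofReal (Real.log b) * ENNReal.ofReal (g x) + 1 := by
    filter_upwards [hcfin] with x hx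
    have hu : (0 : ℝ) ≤ (c x).toReal := ENNReal.toReal_nonneg
    have hk := klFun_nonneg hu
    rw [← ENNReal.ofReal_toReal hx.ne, ENNReal.toReal_ofReal hu]
    have hgx : Real.log b * g x = (c x).toReal * Real.log (c x).toReal := by
      simp only [hg, Real.logb]
      field_simp
    rw [← ENNReal.ofReal_mul hL.le, ← ENNReal.ofReal_mul hL.le, ← ENNReal.ofReal_add hk hu,
      ← ENNReal.ofReal_one, mul_neg, hgx]
    rw [klFun_apply] at hk ⊢
    rcases le_total 0 ((c x).toReal * Real.log (c x).toReal) with h | h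
    · rw [ENNReal.ofReal_of_nonpos (neg_nonpos.2 h), add_zero, ← ENNReal.ofReal_add h zero_le_one]
      ring_nf
    · rw [ENNReal.ofReal_of_nonpos h, zero_add, ← ENNReal.ofReal_add (by linarith) (by linarith)]
      ring_nf
  have hint := lintegral_congr_ae hpt
  have hkm : Measurable fun x => ENNReal.ofReal (klFun (c x).toReal) :=
    (measurable_klFun.comp hc.ennreal_toReal).ennreal_ofReal
  rw [lintegral_add_left (by exact hkm.add hc), lintegral_add_left hkm, hc1,
    lintegral_const_mul _ (by exact hgm.neg.ennreal_ofReal), lintegral_add_right _ measurable_const,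
    lintegral_const_mul _ hgm.ennreal_ofReal, lintegral_const, measure_univ, mul_one, add_right_comm,
    ENNReal.add_left_inj ENNReal.one_ne_top] at hint
  have hdiv : (∫⁻ x, ENNReal.ofReal (klFun (c x).toReal) ∂ρ) / ENNReal.ofReal (Real.log b) +
      ∫⁻ x, ENNReal.ofReal (-g x) ∂ρ = ∫⁻ x, ENNReal.ofReal (g x) ∂ρ := by
    rw [← ENNReal.mul_right_inj hL0 ENNReal.ofReal_ne_top, mul_add,
      ENNReal.mul_div_cancel hL0 ENNReal.ofReal_ne_top, hint]
  have hN : ∫⁻ x, (-((g x : ℝ) : EReal)).toENNReal ∂ρ = ∫⁻ x, ENNReal.ofReal (-g x) ∂ρ :=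
    lintegral_congr fun x => by rw [← EReal.coe_neg, EReal.real_coe_toENNReal]
  change ((∫⁻ x, ENNReal.ofReal (g x) ∂ρ : ℝ≥0∞) : EReal) -
    ((∫⁻ x, (-((g x : ℝ) : EReal)).toENNReal ∂ρ : ℝ≥0∞) : EReal) = _
  rw [hN, ← hdiv, EReal.coe_ennreal_add]
  generalize (∫⁻ x, ENNReal.ofReal (-g x) ∂ρ) = N at hneg
  lift N to NNReal using hneg
  exact EReal.add_sub_cancel_right (b := (N : ℝ))

section Density

variable {α : Type*} [MeasurableSpace α] {ν : Measure α} [SigmaFinite ν]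
  {ρ : Measure ℝ} [IsProbabilityMeasure ρ] {f : α × ℝ → ℝ≥0∞}

lemma fst_withDensity_prod (hf : Measurable f) :
    ((ν.prod ρ).withDensity f).fst = ν.withDensity fun ξ => ∫⁻ φ, f (ξ, φ) ∂ρ := by
  ext A hA
  rw [Measure.fst_apply hA, withDensity_apply _ (measurable_fst hA), withDensity_apply _ hA,
    ← Set.prod_univ, ← Measure.prod_restrict, Measure.restrict_univ, lintegral_prod _ hf.aemeasurable]

lemma withDensity_condDensity (hf : Measurable f) (hfin : ∫⁻ p, f p ∂(ν.prod ρ) ≠ ∞) :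
    (((ν.prod ρ).withDensity f).fst.prod ρ).withDensity
      (fun p => f p / ∫⁻ φ, f (p.1, φ) ∂ρ) = (ν.prod ρ).withDensity f := by
  have hF : Measurable fun ξ => ∫⁻ φ, f (ξ, φ) ∂ρ := hf.lintegral_prod_right'
  have hF1 : Measurable fun p : α × ℝ => ∫⁻ φ, f (p.1, φ) ∂ρ := hF.comp measurable_fst
  rw [fst_withDensity_prod hf, prod_withDensity_left hF,
    ← withDensity_mul (g := fun p => f p / ∫⁻ φ, f (p.1, φ) ∂ρ) _ hF1 (hf.div hF1)]
  refine withDensity_congr_ae ?_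
  rw [lintegral_prod _ hf.aemeasurable] at hfin
  refine (Measure.ae_prod_iff_ae_ae (measurableSet_eq_fun (hF1.mul (hf.div hF1)) hf)).2 ?_
  filter_upwards [ae_lt_top hF hfin] with ξ hξ
  -- Where the marginal vanishes the quotient is degenerate, but there `f` is zero for almost every
  -- `φ`.
  by_cases h0 : ∫⁻ φ, f (ξ, φ) ∂ρ = 0
  · filter_upwards [(lintegral_eq_zero_iff (hf.comp measurable_prodMk_left)).1 h0] with φ hφ
    have hφ' : f (ξ, φ) = 0 := hφ
    simp [hφ']
  · exact ae_of_all _ fun φ => ENNReal.mul_div_cancel h0 hξ.ne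

/-- The conditional density is the Radon–Nikodym derivative of the joint law with respect to its
marginal times `ρ`. -/
lemma klDiv_withDensity_prod (hf : Measurable f) (hf1 : ∫⁻ p, f p ∂(ν.prod ρ) = 1) :
    klDiv ((ν.prod ρ).withDensity f) (((ν.prod ρ).withDensity f).fst.prod ρ) =
      ∫⁻ ξ, (∫⁻ φ, f (ξ, φ) ∂ρ) *
        ∫⁻ φ, ENNReal.ofReal (klFun (f (ξ, φ) / ∫⁻ φ, f (ξ, φ) ∂ρ).toReal) ∂ρ ∂ν := by
  have hF : Measurable fun ξ => ∫⁻ φ, f (ξ, φ) ∂ρ := hf.lintegral_prod_right'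
  have hc : Measurable fun p : α × ℝ => f p / ∫⁻ φ, f (p.1, φ) ∂ρ :=
    hf.div (hF.comp measurable_fst)
  have hk : Measurable fun p : α × ℝ =>
      ENNReal.ofReal (klFun (f p / ∫⁻ φ, f (p.1, φ) ∂ρ).toReal) :=
    (measurable_klFun.comp hc.ennreal_toReal).ennreal_ofReal
  have hfm : IsFiniteMeasure ((ν.prod ρ).withDensity f) :=
    isFiniteMeasure_withDensity (by simp [hf1])
  have hwd := withDensity_condDensity (ν := ν) (ρ := ρ) hf (by simp [hf1])
  have hac : (ν.prod ρ).withDensity f ≪ ((ν.prod ρ).withDensity f).fst.prod ρ := by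
    conv_lhs => rw [← hwd]
    exact withDensity_absolutelyContinuous _ _
  have hrn := Measure.rnDeriv_withDensity (((ν.prod ρ).withDensity f).fst.prod ρ) hc
  rw [hwd] at hrn
  rw [klDiv_eq_lintegral_klFun_of_ac hac]
  calc _ = ∫⁻ p, ENNReal.ofReal (klFun (f p / ∫⁻ φ, f (p.1, φ) ∂ρ).toReal)
        ∂(((ν.prod ρ).withDensity f).fst.prod ρ) := by
        refine lintegral_congr_ae ?_
        filter_upwards [hrn] with p hp
        rw [hp]
    _ = _ := by
        rw [lintegral_prod _ hk.aemeasurable, fst_withDensity_prod hf,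
          lintegral_withDensity_eq_lintegral_mul _ hF hk.lintegral_prod_right']
        rfl

end Density

lemma condAngleIntegral_eq {b : ℝ} (hb : 1 < b) {P : Measure Ω} [IsProbabilityMeasure P]
    {X : Ω → Fin (n + 1) → ℂ} (hX : Measurable X) (hXac : P.map X ≪ volume) :
    condAngleIntegral b X P = (klDivBase b (P.map X) (circularize (P.map X)) : EReal) := by
  have hPX := Measure.isProbabilityMeasure_map (μ := P) hX.aemeasurable
  have hL0 : ENNReal.ofReal (Real.log b) ≠ 0 := by simpa using Real.log_pos hb
  set m := (P.map X).map shearedPolar with hm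
  have hmP : m = P.map (fun ω => shearedPolar (X ω)) := Measure.map_map measurable_shearedPolar hX
  have hmprob : IsProbabilityMeasure m :=
    Measure.isProbabilityMeasure_map measurable_shearedPolar.aemeasurable
  have hmac : m ≪ volume := absolutelyContinuous_map_shearedPolar hXac
  set f := shearedPdf X P with hf
  have hfm : Measurable f := measurable_pdf _ _ _
  have hfdef : f = m.rnDeriv volume := by rw [hf, shearedPdf, pdf_def, hmP]
  -- The angle always lies in `[0,1)`, so Lebesgue measure can be replaced by a reference whose last
  -- factor is a probability measure.
  have hmf : m = (volume.prod unifTurn).withDensity f := by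
    have hr : m.restrict (univ ×ˢ Ico (0 : ℝ) 1) = m := by
      refine Measure.restrict_eq_self_of_ae_mem ?_
      rw [hm]
      refine (ae_map_iff measurable_shearedPolar.aemeasurable
        (MeasurableSet.univ.prod measurableSet_Ico)).2 (ae_of_all _ fun z => ?_)
      exact ⟨mem_univ _, angle_mem_Ico _⟩
    have hu : (volume : Measure ((Fin (n + 1) → ℝ) × (Fin n → ℝ))).prod unifTurn =
        (volume : Measure (((Fin (n + 1) → ℝ) × (Fin n → ℝ)) × ℝ)).restrict
          (univ ×ˢ Ico (0 : ℝ) 1) := by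
      rw [Measure.volume_eq_prod (((Fin (n + 1) → ℝ) × (Fin n → ℝ))) ℝ, ← Measure.prod_restrict,
        Measure.restrict_univ]
    rw [hu, ← restrict_withDensity (MeasurableSet.univ.prod measurableSet_Ico), hfdef,
      Measure.withDensity_rnDeriv_eq _ _ hmac, hr]
  have hf1 : ∫⁻ p, f p ∂((volume : Measure ((Fin (n + 1) → ℝ) × (Fin n → ℝ))).prod unifTurn)
      = 1 := by
    rw [← setLIntegral_univ, ← withDensity_apply _ MeasurableSet.univ, ← hmf, measure_univ]
  have hred : reducedPdf X P = fun ξ => ∫⁻ φ, f (ξ, φ) ∂unifTurn := rfl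
  have hFm : Measurable (reducedPdf X P) := hfm.lintegral_prod_right'
  have hFfin : ∀ᵐ ξ, reducedPdf X P ξ < ∞ := by
    refine ae_lt_top hFm ?_
    rw [hred, ← lintegral_prod _ hfm.aemeasurable, hf1]
    exact ENNReal.one_ne_top
  let K : ((Fin (n + 1) → ℝ) × (Fin n → ℝ)) → ℝ≥0∞ := fun ξ =>
    ∫⁻ φ, ENNReal.ofReal (klFun (condPdf X P ξ φ).toReal) ∂unifTurn
  have hS : MeasurableSet (reducedSupport X P) := hFm (measurableSet_singleton 0).compl
  have hinner : ∀ᵐ ξ ∂volume.restrict (reducedSupport X P),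
      (reducedPdf X P ξ : EReal) * extIntegral unifTurn (fun φ =>
        (((condPdf X P ξ φ).toReal * Real.logb b (condPdf X P ξ φ).toReal : ℝ) : EReal)) =
      ((reducedPdf X P ξ * (K ξ / ENNReal.ofReal (Real.log b)) : ℝ≥0∞) : EReal) := by
    filter_upwards [ae_restrict_mem hS, ae_restrict_of_ae hFfin] with ξ h0 hfin
    have hcm : Measurable (condPdf X P ξ) :=
      (hfm.comp measurable_prodMk_left).div_const _
    have hc1 : ∫⁻ φ, condPdf X P ξ φ ∂unifTurn = 1 := by
      simp only [condPdf, div_eq_mul_inv]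
      rw [lintegral_mul_const _ (by exact hfm.comp measurable_prodMk_left)]
      exact ENNReal.mul_inv_cancel h0 hfin.ne
    rw [extIntegral_mul_logb unifTurn hb hcm hc1, EReal.coe_ennreal_mul]
  have hkl : klDiv m (m.fst.prod unifTurn) = ∫⁻ ξ, reducedPdf X P ξ * K ξ := by
    rw [hmf, klDiv_withDensity_prod hfm hf1]
    rfl
  have hpos : ∫⁻ ξ in reducedSupport X P, ((reducedPdf X P ξ : EReal) *
      extIntegral unifTurn (fun φ => (((condPdf X P ξ φ).toReal *
        Real.logb b (condPdf X P ξ φ).toReal : ℝ) : EReal))).toENNReal =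
      klDivBase b (P.map X) (circularize (P.map X)) := by
    rw [klDivBase, klDiv_circularize _ hXac, hkl, lintegral_congr_ae
      (hinner.mono fun ξ hξ => by rw [hξ, EReal.toENNReal_coe]),
      -- The integrand has the reduced density as a factor, so it vanishes off the support.
      setLIntegral_eq_of_support_subset (s := reducedSupport X P)
        fun ξ hξ => left_ne_zero_of_mul hξ]
    simp only [div_eq_mul_inv, ← mul_assoc]
    exact lintegral_mul_const' _ _ (ENNReal.inv_ne_top.2 hL0)
  -- The inner integral is a divergence, hence nonnegative, so the outer integral has no negative
  -- part.
  have hneg : ∫⁻ ξ in reducedSupport X P, (-((reducedPdf X P ξ : EReal) *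
      extIntegral unifTurn (fun φ => (((condPdf X P ξ φ).toReal *
        Real.logb b (condPdf X P ξ φ).toReal : ℝ) : EReal)))).toENNReal = 0 := by
    rw [lintegral_congr_ae (g := 0), Pi.zero_def, lintegral_zero]
    refine hinner.mono fun ξ hξ => ?_
    beta_reduce
    rw [hξ]
    exact EReal.toENNReal_of_nonpos (by simp [-EReal.coe_ennreal_mul, EReal.coe_ennreal_nonneg])
  rw [condAngleIntegral, extIntegral, hpos, hneg]
  simp

end CircularAnalog

theorem mainTheorem3 {n : ℕ} {Ω : Type*} [MeasurableSpace Ω]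
    (P : Measure Ω) [IsProbabilityMeasure P]
    (b : ℝ) (hb : 1 < b)
    (X : Ω → Fin (n + 1) → ℂ) (hX : Measurable X) (hXac : P.map X ≪ volume)
    (ψ : Ω → ℝ) (hψ : Measurable ψ) (hψunif : pdf.IsUniform ψ (Ico (0 : ℝ) 1) P volume)
    (hindep : IndepFun ψ X P) :
    P.map (CircularAnalog.analog ψ X) ∈ CircularAnalog.circularLaws (n + 1) ∧
    (∀ {Ω' : Type*} [MeasurableSpace Ω'] (P' : Measure Ω') [IsProbabilityMeasure P']
      (Y : Ω' → Fin (n + 1) → ℂ), Measurable Y → P'.map Y ≪ volume →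
      CircularAnalog.IsCircular Y P' →
      (IdentDistrib Y (CircularAnalog.analog ψ X) P' P →
        CircularAnalog.klDivBase b (P.map X) (P'.map Y) =
          ⨅ c ∈ CircularAnalog.circularLaws (n + 1),
            CircularAnalog.klDivBase b (P.map X) c) ∧
      ((⨅ c ∈ CircularAnalog.circularLaws (n + 1),
          CircularAnalog.klDivBase b (P.map X) c) ≠ ∞ →
        CircularAnalog.klDivBase b (P.map X) (P'.map Y) =
          (⨅ c ∈ CircularAnalog.circularLaws (n + 1),
            CircularAnalog.klDivBase b (P.map X) c) →
        IdentDistrib Y (CircularAnalog.analog ψ X) P' P)) ∧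
    CircularAnalog.klDivBase b (P.map X) (P.map (CircularAnalog.analog ψ X)) =
      (⨅ c ∈ CircularAnalog.circularLaws (n + 1), CircularAnalog.klDivBase b (P.map X) c) ∧
    ((⨅ c ∈ CircularAnalog.circularLaws (n + 1),
        CircularAnalog.klDivBase b (P.map X) c : ℝ≥0∞) : EReal) =
      CircularAnalog.condAngleIntegral b X P := by
  have hPX := Measure.isProbabilityMeasure_map (μ := P) hX.aemeasurable
  have hlaw := CircularAnalog.map_analog hX hψ hψunif hindep
  rw [CircularAnalog.iInf_klDivBase_circularLaws b (P.map X) hXac, hlaw,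
    CircularAnalog.condAngleIntegral_eq hb hX hXac]
  refine ⟨CircularAnalog.circularize_mem_circularLaws _ hXac, ?_, rfl, rfl⟩
  intro Ω' _ P' _ Y hY hYac hYcirc
  refine ⟨fun h => by rw [h.map_eq, hlaw], fun hfin h => ?_⟩
  have hmem : P'.map Y ∈ CircularAnalog.circularLaws (n + 1) := by
    refine ⟨Measure.isProbabilityMeasure_map hY.aemeasurable, hYac, ?_⟩
    rw [CircularAnalog.isCircular_id_iff]
    intro θ hθ
    rw [Measure.map_map (CircularAnalog.measurable_rotate θ) hY]
    exact (hYcirc θ hθ).map_eq.symm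
  refine ⟨hY.aemeasurable, ?_, ?_⟩
  · exact (CircularAnalog.measurable_rotate_uncurry.comp (hψ.prodMk hX)).aemeasurable
  · rw [hlaw]
    exact CircularAnalog.eq_circularize_of_klDivBase_eq hb _ hXac hmem hfin h
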